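/- **Theorem 1 (Alternating service system).** Let $n\ge 1$ be an integer and $\mu>0$. Let $A\ge 0$ be a service time with an arbitrary distribution on $[0,\infty)$, and let the preparation time $B$ have the Erlang-$n$ distribution with rate $\mu$, i.e. the distribution of the sum of $n$ independent exponential random variables with parameter $\mu$. Then there is exactly one probability distribution for $W$ such that $$W \overset{D}{=} \max\{0,\,B-A-W\},$$ where $A$, $B$ and $W$ on the right-hand side are independent. Let $W$ have this distribution, with $A,B,W$ independent, let $\omega(s)=E[e^{-sW}]$ and $\alpha(s)=E[e^{-sA}]$ be the Laplace transforms of $W$ and $A$ (which are infinitely differentiable on $(0,\infty)$), and let $\phi(s)=\omega(s)\alpha(s)$; $g^{(i)}$ denotes the $i$-th derivative of $g$. Then the distribution of $W$ has a mass $p_0$ at the origin, given by $$p_0=P[W=0]=P[B<W+A]=1-\sum_{i=0}^{n-1}\frac{(-\mu)^i}{i!}\,\phi^{(i)}(\mu),$$ and on $[0,\infty)$ it has otherwise the (nonnegative) density $$f_W(x)=\mu^n e^{-\mu x}\sum_{i=0}^{n-1}\frac{(-1)^i}{i!}\,\phi^{(i)}(\mu)\,\frac{x^{n-1-i}}{(n-1-i)!},$$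 that is, the distribution of $W$ is $p_0\delta_0+f_W(x)\mathbf 1_{[0,\infty)}(x)\,dx$. Here, for $i=0,\dots,n-1$, $$\phi^{(i)}(\mu)=\sum_{k=0}^{i}\binom ik\,\omega^{(k)}(\mu)\,\alpha^{(i-k)}(\mu),$$ and the numbers $\omega^{(i)}(\mu)$, $i=0,\dots,n-1$, are the unique solution of the system of linear equations $$\omega(\mu)=1-\sum_{i=0}^{n-1}(-\mu)^i\Bigl(1-\frac1{2^{n-i}}\Bigr)\sum_{k=0}^{i}\frac{\omega^{(k)}(\mu)\,\alpha^{(i-k)}(\mu)}{k!\,(i-k)!},$$ $$\omega^{(\ell)}(\mu)=\sum_{i=0}^{n-1}\mu^{i-\ell}\,\frac{(-1)^{i+\ell}}{2^{n-i+\ell}}\,\frac{(n-i+\ell-1)!}{(n-i-1)!}\sum_{k=0}^{i}\frac{\omega^{(k)}(\mu)\,\alpha^{(i-k)}(\mu)}{k!\,(i-k)!},\qquad \ell=1,\dots,n-1.$$ -/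

import Mathlib

open MeasureTheory ProbabilityTheory
open scoped Nat ContDiff

/-- The Laplace transform `s ↦ ∫ e^{-s x} ν(dx)` of a law `ν` on the real line. -/
noncomputable def laplaceTransform (ν : Measure ℝ) (s : ℝ) : ℝ :=
  ∫ x, Real.exp (-(s * x)) ∂ν

/-- The Erlang law: the law of the sum of `n` independent exponential random variables
with rate `μ`. -/
noncomputable def erlangLaw (n : ℕ) (μ : ℝ) : Measure ℝ :=
  (Measure.pi fun _ : Fin n => expMeasure μ).map fun x => ∑ i, x i

/-- `ν` is a stationary law of the recursion `W' = max {0, B - A - W}`, where `A`, `B`, `W` are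
independent and `A`, `B` have the laws `FA`, `FB`. -/
def IsStationaryLaw (FA FB ν : Measure ℝ) : Prop :=
  IsProbabilityMeasure ν ∧
    (FA.prod (FB.prod ν)).map (fun z : ℝ × ℝ × ℝ => max 0 (z.2.1 - z.1 - z.2.2)) = ν

/-- The `n × n` linear system for unknowns `y 0, …, y (n - 1)`, with given coefficients
`a j` (the `j`-th derivative at `μ` of the Laplace transform of the service time).
Only the values `y k` with `k < n` enter. -/
def SolvesBalanceSystem (n : ℕ) (μ : ℝ) (a y : ℕ → ℝ) : Prop :=
  (y 0 = 1 - ∑ i ∈ Finset.range n, (-μ) ^ i * (1 - 1 / 2 ^ (n - i)) *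
      ∑ k ∈ Finset.range (i + 1), y k * a (i - k) / (k ! * (i - k)! : ℝ)) ∧
  ∀ l : ℕ, 1 ≤ l → l < n →
    y l = ∑ i ∈ Finset.range n,
      μ ^ ((i : ℤ) - (l : ℤ)) * ((-1) ^ (i + l) / 2 ^ (n - i + l)) *
        (((n - i + l - 1)! : ℝ) / ((n - i - 1)! : ℝ)) *
        ∑ k ∈ Finset.range (i + 1), y k * a (i - k) / (k ! * (i - k)! : ℝ)

/-!
The recursion can be followed through the exponential phases of `B`. Put `U = A + W`. Given
`U = u`, the number of phases of `B` that are over at time `u` is a Poisson variable, cut off at `n`,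
and by memorylessness `max {0, B - u}` is an Erlang variable with the remaining phases, no phases
meaning the value `0` (`map_erlangLaw_max_sub`). So the law of `max {0, B - A - W}` is always a
mixture of the laws `erlangLaw (n - i) μ`, `i ≤ n`, with weights that are the distribution of the
number of completed phases at time `A + W` (`map_max_sub_sub_eq_erlangMix`). These weights are
`E[(μ U)^i / i! e^{-μ U}] = (-μ)^i / i! φ^{(i)}(μ)` for `i < n` (`meanWeight_of_lt`), which gives
the mass at the origin and the density.

A stationary law is therefore the same as a stationary distribution of a Markov chain with the
states `0, …, n`, whose transition matrix is `phaseMatrix`. Its column `0` is positive, because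
`E[e^{-μ (A + W)}] > 0` (`phaseMatrix_zero_pos`). Hence a stationary distribution exists and is
unique, even among signed vectors of a given sum (`exists_stationary_vector`,
`eq_zero_of_vecMul_eq_self`).

The linear system says that the numbers `y l` are the derivatives at `μ` of the Laplace transform
of the signed mixture of Erlang laws whose weights are computed from `y`
(`solvesBalanceSystem_iff`). The weights of a solution are fixed by the chain
(`balanceWeight_eq_sum_phaseMatrix`), so the solution is unique (`SolvesBalanceSystem.unique`), and
the uniqueness of the stationary law follows from this as well.
-/

/-! ### Stochastic matrices with a positive column -/

/-- Doeblin's argument: a stochastic matrix with a positive column contracts the `ℓ¹` norm strictly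
on vectors of sum zero, so none of them but `0` is fixed. The vector `v` may be signed. -/
theorem eq_zero_of_vecMul_eq_self {ι : Type*} [Fintype ι] [DecidableEq ι] {M : Matrix ι ι ℝ}
    (hM : ∀ j i, 0 ≤ M j i) (hM1 : ∀ j, ∑ i, M j i = 1) (i₀ : ι) (hpos : ∀ j, 0 < M j i₀)
    {v : ι → ℝ} (hv : ∀ i, v i = ∑ j, v j * M j i) (hv0 : ∑ i, v i = 0) : v = 0 := by
  obtain ⟨δ, hδ, hδM⟩ : ∃ δ > 0, ∀ j, δ ≤ M j i₀ := by
    obtain ⟨j₁, -, h⟩ := Finset.exists_min_image Finset.univ (fun j => M j i₀) ⟨i₀, by simp⟩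
    exact ⟨_, hpos j₁, fun j => h j (by simp)⟩
  set N : ι → ι → ℝ := fun j i => M j i - if i = i₀ then δ else 0 with hN
  have hN0 : ∀ j i, 0 ≤ N j i := by
    intro j i
    simp only [hN]
    split_ifs with h
    · subst h; linarith [hδM j]
    · simpa using hM j i
  have hN1 : ∀ j, ∑ i, N j i = 1 - δ := by
    intro j; simp [hN, Finset.sum_sub_distrib, hM1]
  -- since `v` sums to zero, `δ` may be subtracted from the positive column
  have hvN : ∀ i, v i = ∑ j, v j * N j i := by
    intro i
    simp only [hN, mul_sub, Finset.sum_sub_distrib, ← Finset.sum_mul, hv0, zero_mul, sub_zero]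
    exact hv i
  have key : ∑ i, |v i| ≤ (1 - δ) * ∑ i, |v i| := calc
    ∑ i, |v i| ≤ ∑ i, ∑ j, |v j| * N j i := by
      refine Finset.sum_le_sum fun i _ => ?_
      conv_lhs => rw [hvN i]
      refine (Finset.abs_sum_le_sum_abs _ _).trans (Finset.sum_le_sum fun j _ => ?_)
      rw [abs_mul, abs_of_nonneg (hN0 j i)]
    _ = (1 - δ) * ∑ i, |v i| := by
      rw [Finset.sum_comm, Finset.mul_sum]
      refine Finset.sum_congr rfl fun j _ => ?_
      rw [← Finset.mul_sum, hN1, mul_comm]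
  have hS : ∑ i, |v i| = 0 :=
    le_antisymm (by nlinarith) (Finset.sum_nonneg fun i _ => abs_nonneg _)
  funext i
  simpa using (Finset.sum_eq_zero_iff_of_nonneg fun i _ => abs_nonneg (v i)).1 hS i (by simp)

/-- A finite stochastic matrix `M` has a stationary probability vector: `1 - M` is singular, and
the absolute value of a fixed vector is again fixed. -/
theorem exists_stationary_vector {ι : Type*} [Fintype ι] [DecidableEq ι] [Nonempty ι]
    {M : Matrix ι ι ℝ} (hM : ∀ j i, 0 ≤ M j i) (hM1 : ∀ j, ∑ i, M j i = 1) :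
    ∃ q : ι → ℝ, (∀ i, 0 ≤ q i) ∧ ∑ i, q i = 1 ∧ ∀ i, q i = ∑ j, q j * M j i := by
  have hdet : (1 - M).det = 0 := by
    refine Matrix.exists_mulVec_eq_zero_iff.1 ⟨1, one_ne_zero, ?_⟩
    funext j
    rw [Matrix.sub_mulVec, Matrix.one_mulVec]
    simp [Matrix.mulVec, dotProduct, hM1]
  obtain ⟨v, hv0, hv⟩ := Matrix.exists_vecMul_eq_zero_iff.2 hdet
  have hv' : ∀ i, v i = ∑ j, v j * M j i := by
    intro i
    have := congrFun hv i
    simp only [Matrix.vecMul_sub, Matrix.vecMul_one, Pi.sub_apply, Pi.zero_apply,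
      sub_eq_zero] at this
    exact this
  -- `|v| ≤ |v| M` holds entrywise and both sides have the same sum
  have hle : ∀ i ∈ Finset.univ, |v i| ≤ ∑ j, |v j| * M j i := by
    intro i _
    conv_lhs => rw [hv' i]
    refine (Finset.abs_sum_le_sum_abs _ _).trans (Finset.sum_le_sum fun j _ => ?_)
    rw [abs_mul, abs_of_nonneg (hM j i)]
  have hsum : ∑ i, |v i| = ∑ i, ∑ j, |v j| * M j i := by
    rw [Finset.sum_comm]
    simp [← Finset.mul_sum, hM1]
  have heq := (Finset.sum_eq_sum_iff_of_le hle).1 hsum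
  have hpos : 0 < ∑ i, |v i| := by
    obtain ⟨i, hi⟩ := Function.ne_iff.1 hv0
    exact Finset.sum_pos' (fun i _ => abs_nonneg _) ⟨i, by simp, abs_pos.2 hi⟩
  refine ⟨fun i => |v i| / ∑ i, |v i|, fun i => by positivity, ?_, fun i => ?_⟩
  · rw [← Finset.sum_div, div_self hpos.ne']
  · simp only [div_mul_eq_mul_div, ← Finset.sum_div]
    rw [← heq i (by simp)]

/-! ### Erlang laws -/

/-- The density of the Erlang law with `m + 1` phases of rate `μ`. -/
noncomputable def erlangPDF (m : ℕ) (μ x : ℝ) : ℝ :=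
  if 0 ≤ x then μ ^ (m + 1) * x ^ m / m ! * Real.exp (-(μ * x)) else 0

theorem measurable_erlangPDF (m : ℕ) (μ : ℝ) : Measurable (erlangPDF m μ) := by
  unfold erlangPDF
  exact Measurable.ite measurableSet_Ici (by fun_prop) measurable_const

theorem erlangPDF_nonneg (m : ℕ) {μ : ℝ} (hμ : 0 < μ) (x : ℝ) : 0 ≤ erlangPDF m μ x := by
  unfold erlangPDF
  split_ifs <;> positivity

theorem erlangLaw_zero (μ : ℝ) : erlangLaw 0 μ = Measure.dirac 0 := by
  rw [erlangLaw, Measure.pi_of_empty, Measure.map_dirac' (by fun_prop)]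
  simp

theorem isProbabilityMeasure_erlangLaw (n : ℕ) {μ : ℝ} (hμ : 0 < μ) :
    IsProbabilityMeasure (erlangLaw n μ) := by
  have := isProbabilityMeasure_expMeasure hμ
  exact Measure.isProbabilityMeasure_map (by fun_prop)

theorem erlangLaw_succ (n : ℕ) {μ : ℝ} (hμ : 0 < μ) :
    erlangLaw (n + 1) μ = erlangLaw n μ ∗ expMeasure μ := by
  have := isProbabilityMeasure_expMeasure hμ
  have := isProbabilityMeasure_erlangLaw n hμ
  have h := measurePreserving_piFinSuccAbove (fun _ : Fin (n + 1) => expMeasure μ) 0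
  rw [Measure.conv_comm, Measure.conv, erlangLaw, erlangLaw]
  have h1 : (expMeasure μ).prod
      ((Measure.pi fun _ : Fin n => expMeasure μ).map fun x => ∑ i, x i) =
      ((expMeasure μ).prod (Measure.pi fun _ : Fin n => expMeasure μ)).map
        (Prod.map id fun x => ∑ i, x i) := by
    rw [← Measure.map_prod_map _ _ measurable_id (by fun_prop), Measure.map_id]
  rw [h1, ← h.map_eq, Measure.map_map (by fun_prop) (by fun_prop),
    Measure.map_map (by fun_prop) (by fun_prop)]
  congr 1
  funext x
  simp [Fin.sum_univ_succ, MeasurableEquiv.piFinSuccAbove, Fin.insertNthEquiv, Fin.tail]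

theorem erlangLaw_one {μ : ℝ} (hμ : 0 < μ) : erlangLaw 1 μ = expMeasure μ := by
  have := isProbabilityMeasure_expMeasure hμ
  rw [erlangLaw_succ 0 hμ, erlangLaw_zero, Measure.dirac_zero_conv]

theorem expMeasure_eq_withDensity (μ : ℝ) :
    expMeasure μ = volume.withDensity fun x => ENNReal.ofReal (erlangPDF 0 μ x) := by
  rw [expMeasure, gammaMeasure]
  congr 1
  funext x
  simp [gammaPDF_eq, erlangPDF]

theorem lconvolution_erlangPDF (m : ℕ) {μ : ℝ} (hμ : 0 < μ) (x : ℝ) :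
    ∫⁻ y, ENNReal.ofReal (erlangPDF m μ y) * ENNReal.ofReal (erlangPDF 0 μ (-y + x)) =
      ENNReal.ofReal (erlangPDF (m + 1) μ x) := by
  have h : ∀ y, ENNReal.ofReal (erlangPDF m μ y) * ENNReal.ofReal (erlangPDF 0 μ (-y + x)) =
      (Set.Icc 0 x).indicator (fun y => ENNReal.ofReal
        (μ ^ (m + 2) * Real.exp (-(μ * x)) / m ! * y ^ m)) y := by
    intro y
    rw [← ENNReal.ofReal_mul (erlangPDF_nonneg m hμ y)]
    by_cases hy : y ∈ Set.Icc 0 x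
    · rw [Set.indicator_of_mem hy]
      congr 1
      have : Real.exp (-(μ * x)) = Real.exp (-(μ * y)) * Real.exp (-(μ * (-y + x))) := by
        rw [← Real.exp_add]; ring_nf
      rw [erlangPDF, erlangPDF, if_pos hy.1, if_pos (by linarith [hy.2]), this]
      simp
      ring
    · rw [Set.indicator_of_notMem hy]
      rw [Set.mem_Icc, not_and_or] at hy
      rcases hy with hy | hy
      · simp [erlangPDF, hy]
      · simp [erlangPDF, show ¬ (0 ≤ -y + x) by linarith]
  simp_rw [h]
  rw [lintegral_indicator measurableSet_Icc]
  by_cases hx : 0 ≤ x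
  · rw [← ofReal_integral_eq_lintegral_ofReal, integral_Icc_eq_integral_Ioc,
      ← intervalIntegral.integral_of_le hx]
    · congr 1
      rw [intervalIntegral.integral_const_mul, integral_pow, erlangPDF, if_pos hx,
        Nat.factorial_succ]
      push_cast
      field_simp
      ring
    · exact (Continuous.integrableOn_Icc (by fun_prop))
    · refine (ae_restrict_iff' measurableSet_Icc).2 (ae_of_all _ fun y hy => ?_)
      have := hy.1
      simp only [Pi.zero_apply]
      positivity
  · rw [Set.Icc_eq_empty hx]
    simp [erlangPDF, hx]

theorem erlangLaw_eq_withDensity (m : ℕ) {μ : ℝ} (hμ : 0 < μ) :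
    erlangLaw (m + 1) μ = volume.withDensity fun x => ENNReal.ofReal (erlangPDF m μ x) := by
  induction m with
  | zero => rw [erlangLaw_one hμ, expMeasure_eq_withDensity]
  | succ m ih =>
    have h0 := (measurable_erlangPDF 0 μ).ennreal_ofReal
    have hm := (measurable_erlangPDF m μ).ennreal_ofReal
    have : IsProbabilityMeasure
        (volume.withDensity fun x => ENNReal.ofReal (erlangPDF m μ x)) :=
      ih ▸ isProbabilityMeasure_erlangLaw _ hμ
    rw [erlangLaw_succ _ hμ, ih, expMeasure_eq_withDensity,
      conv_withDensity_eq_lconvolution hm h0]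
    congr 1
    funext x
    exact lconvolution_erlangPDF m hμ x

theorem ae_nonneg_erlangLaw (n : ℕ) {μ : ℝ} (hμ : 0 < μ) : ∀ᵐ x ∂erlangLaw n μ, 0 ≤ x := by
  cases n with
  | zero => rw [erlangLaw_zero, ae_dirac_iff measurableSet_Ici]
  | succ m =>
    rw [erlangLaw_eq_withDensity m hμ, ae_withDensity_iff (measurable_erlangPDF m μ).ennreal_ofReal]
    refine ae_of_all _ fun x hx => ?_
    by_contra h
    simp [erlangPDF, h] at hx

theorem erlangLaw_singleton (m : ℕ) {μ : ℝ} (hμ : 0 < μ) (x : ℝ) :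
    erlangLaw (m + 1) μ {x} = 0 := by
  rw [erlangLaw_eq_withDensity m hμ]
  exact withDensity_absolutelyContinuous _ _ Real.volume_singleton

/-! ### One step of the recursion -/

/-- The probability that a Poisson process of rate `μ` has exactly `i` points in `[0, u]`. -/
noncomputable def poissonWeight (μ : ℝ) (i : ℕ) (u : ℝ) : ℝ :=
  (μ * u) ^ i / i ! * Real.exp (-(μ * u))

/-- The probability that exactly `i` of the `n` phases of an Erlang variable are over at time `u`,
for `i ≤ n`. -/
noncomputable def stepWeight (n : ℕ) (μ : ℝ) (i : ℕ) (u : ℝ) : ℝ :=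
  if i < n then poissonWeight μ i u else 1 - ∑ k ∈ Finset.range n, poissonWeight μ k u

theorem measurable_poissonWeight (μ : ℝ) (i : ℕ) : Measurable (poissonWeight μ i) := by
  unfold poissonWeight; fun_prop

theorem measurable_stepWeight (n : ℕ) (μ : ℝ) (i : ℕ) : Measurable (stepWeight n μ i) := by
  have := measurable_poissonWeight μ
  unfold stepWeight
  split_ifs <;> fun_prop

theorem poissonWeight_nonneg {μ u : ℝ} (hμ : 0 < μ) (hu : 0 ≤ u) (i : ℕ) :
    0 ≤ poissonWeight μ i u := by
  unfold poissonWeight; positivity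

theorem sum_poissonWeight_le_one {μ u : ℝ} (hμ : 0 < μ) (hu : 0 ≤ u) (n : ℕ) :
    ∑ k ∈ Finset.range n, poissonWeight μ k u ≤ 1 := by
  simp only [poissonWeight]
  rw [← Finset.sum_mul, Real.exp_neg, ← div_eq_mul_inv, div_le_one (Real.exp_pos _)]
  exact Real.sum_le_exp_of_nonneg (by positivity) n

theorem stepWeight_of_lt {n i : ℕ} (μ : ℝ) (hi : i < n) :
    stepWeight n μ i = poissonWeight μ i := by
  funext u; simp [stepWeight, hi]

theorem stepWeight_self (n : ℕ) (μ u : ℝ) :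
    stepWeight n μ n u = 1 - ∑ k ∈ Finset.range n, poissonWeight μ k u := by
  simp [stepWeight]

theorem stepWeight_nonneg {μ u : ℝ} (hμ : 0 < μ) (hu : 0 ≤ u) (n i : ℕ) :
    0 ≤ stepWeight n μ i u := by
  unfold stepWeight
  split_ifs
  · exact poissonWeight_nonneg hμ hu i
  · linarith [sum_poissonWeight_le_one hμ hu n]

theorem sum_stepWeight (n : ℕ) (μ u : ℝ) :
    ∑ i ∈ Finset.range (n + 1), stepWeight n μ i u = 1 := by
  rw [Finset.sum_range_succ, stepWeight_self]
  have : ∑ i ∈ Finset.range n, stepWeight n μ i u = ∑ i ∈ Finset.range n, poissonWeight μ i u :=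
    Finset.sum_congr rfl fun i hi => by rw [stepWeight_of_lt μ (Finset.mem_range.1 hi)]
  linarith

theorem stepWeight_le_one {μ u : ℝ} (hμ : 0 < μ) (hu : 0 ≤ u) {n i : ℕ} (hi : i ≤ n) :
    stepWeight n μ i u ≤ 1 := by
  rw [← sum_stepWeight n μ u]
  exact Finset.single_le_sum (f := fun i => stepWeight n μ i u)
    (fun i _ => stepWeight_nonneg hμ hu n i) (Finset.mem_range.2 (by omega))

theorem erlangPDF_add (m : ℕ) (μ : ℝ) {u y : ℝ} (hu : 0 ≤ u) (hy : 0 ≤ y) :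
    erlangPDF m μ (y + u) =
      ∑ i ∈ Finset.range (m + 1), poissonWeight μ i u * erlangPDF (m - i) μ y := by
  rw [erlangPDF, if_pos (by positivity), add_comm y u, add_pow, mul_add, neg_add, Real.exp_add,
    Finset.mul_sum, Finset.sum_div, Finset.sum_mul]
  refine Finset.sum_congr rfl fun i hi => ?_
  have him : i ≤ m := Nat.lt_succ_iff.1 (Finset.mem_range.1 hi)
  rw [erlangPDF, if_pos hy, poissonWeight, Nat.cast_choose ℝ him, mul_pow,
    show m + 1 = i + (m - i + 1) by omega, pow_add]
  have := (Nat.factorial_pos m).ne'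
  field_simp

/-- Memorylessness: given that `i` phases are over at time `u`, the remaining time is again an
Erlang variable, with `n - i` phases. -/
theorem map_erlangLaw_max_sub (m : ℕ) {μ u : ℝ} (hμ : 0 < μ) (hu : 0 ≤ u) :
    (erlangLaw (m + 1) μ).map (fun b => max 0 (b - u)) =
      ∑ i ∈ Finset.range (m + 2),
        ENNReal.ofReal (stepWeight (m + 1) μ i u) • erlangLaw (m + 1 - i) μ := by
  have hprob := fun n => isProbabilityMeasure_erlangLaw n hμ
  have hmeas : Measurable fun b : ℝ => max 0 (b - u) := by fun_prop
  have hsplit : (erlangLaw (m + 1) μ).map (fun b => max 0 (b - u)) =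
      erlangLaw (m + 1) μ (Set.Iic u) • Measure.dirac 0 + ∑ i ∈ Finset.range (m + 1),
        ENNReal.ofReal (poissonWeight μ i u) • erlangLaw (m + 1 - i) μ := by
    ext s hs
    rw [Measure.map_apply hmeas hs,
      ← measure_inter_add_sdiff _ (measurableSet_Iic (a := u)), Measure.add_apply]
    congr 1
    · by_cases h0 : (0 : ℝ) ∈ s
      · have : (fun b => max 0 (b - u)) ⁻¹' s ∩ Set.Iic u = Set.Iic u := by
          ext b
          simp only [Set.mem_inter_iff, Set.mem_preimage, Set.mem_Iic, and_iff_right_iff_imp]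
          intro hb
          rwa [max_eq_left (by linarith)]
        simp [this, h0]
      · have : (fun b => max 0 (b - u)) ⁻¹' s ∩ Set.Iic u = ∅ := by
          ext b
          simp only [Set.mem_inter_iff, Set.mem_preimage, Set.mem_Iic, Set.mem_empty_iff_false,
            iff_false, not_and']
          intro hb
          rwa [max_eq_left (by linarith)]
        simp [this, h0, hs]
    · have hT := (hmeas hs).diff (measurableSet_Iic (a := u))
      rw [erlangLaw_eq_withDensity m hμ, withDensity_apply _ hT, ← lintegral_indicator hT,
        ← lintegral_add_right_eq_self _ u]
      have hterm : ∀ i ∈ Finset.range (m + 1),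
          ENNReal.ofReal (poissonWeight μ i u) * erlangLaw (m + 1 - i) μ s =
          ∫⁻ y, s.indicator (fun y => ENNReal.ofReal (poissonWeight μ i u) *
            ENNReal.ofReal (erlangPDF (m - i) μ y)) y := by
        intro i hi
        have him : i ≤ m := Nat.lt_succ_iff.1 (Finset.mem_range.1 hi)
        rw [show m + 1 - i = (m - i) + 1 by omega, erlangLaw_eq_withDensity _ hμ,
          withDensity_apply _ hs, lintegral_indicator hs,
          lintegral_const_mul _ (measurable_erlangPDF _ μ).ennreal_ofReal]
      simp only [Measure.coe_finsetSum, Finset.sum_apply, Measure.smul_apply, smul_eq_mul]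
      rw [Finset.sum_congr rfl hterm, ← lintegral_finsetSum _ fun i _ =>
        (((measurable_erlangPDF _ μ).ennreal_ofReal.const_mul _).indicator hs)]
      have hne : ∀ᵐ y : ℝ, y ≠ 0 := by simp [ae_iff]
      refine lintegral_congr_ae ?_
      filter_upwards [hne] with y hy
      rcases lt_or_gt_of_ne hy with hy | hy
      · rw [Set.indicator_of_notMem (by simp [hy.le])]
        symm
        refine Finset.sum_eq_zero fun i _ => ?_
        simp [erlangPDF, hy.not_ge]
      · have hiff : y + u ∈ (fun b => max 0 (b - u)) ⁻¹' s \ Set.Iic u ↔ y ∈ s := by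
          simp [hy, hy.le]
        by_cases hys : y ∈ s
        · rw [Set.indicator_of_mem (hiff.2 hys), erlangPDF_add m μ hu hy.le,
            ENNReal.ofReal_sum_of_nonneg fun i _ =>
              mul_nonneg (poissonWeight_nonneg hμ hu i) (erlangPDF_nonneg _ hμ y)]
          refine Finset.sum_congr rfl fun i _ => ?_
          rw [Set.indicator_of_mem hys, ENNReal.ofReal_mul (poissonWeight_nonneg hμ hu i)]
        · rw [Set.indicator_of_notMem (hiff.not.2 hys)]
          simp [hys]
  -- the weight of the atom is found by comparing total masses
  have hmass : erlangLaw (m + 1) μ (Set.Iic u) =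
      ENNReal.ofReal (stepWeight (m + 1) μ (m + 1) u) := by
    have h1 := congrArg (fun ρ : Measure ℝ => ρ Set.univ) hsplit
    have := Measure.isProbabilityMeasure_map hmeas.aemeasurable (μ := erlangLaw (m + 1) μ)
    simp only [Measure.add_apply, Measure.smul_apply, Measure.coe_finsetSum, Finset.sum_apply,
      measure_univ, smul_eq_mul, mul_one] at h1
    rw [← ENNReal.ofReal_sum_of_nonneg fun i _ => poissonWeight_nonneg hμ hu i] at h1
    rw [stepWeight_self, ENNReal.ofReal_sub _
      (Finset.sum_nonneg fun i _ => poissonWeight_nonneg hμ hu i), ENNReal.ofReal_one, h1,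
      ENNReal.add_sub_cancel_right ENNReal.ofReal_ne_top]
  rw [hsplit, Finset.sum_range_succ _ (m + 1), hmass, Nat.sub_self, erlangLaw_zero, add_comm]
  congr 1
  exact Finset.sum_congr rfl fun i hi => by rw [stepWeight_of_lt μ (Finset.mem_range.1 hi)]

/-- The mixture that gives weight `q i` to the Erlang law with `n - i` phases, `i ≤ n`;
the law with no phases is the unit mass at the origin. -/
noncomputable def erlangMix (n : ℕ) (μ : ℝ) (q : ℕ → ℝ) : Measure ℝ :=
  ∑ i ∈ Finset.range (n + 1), ENNReal.ofReal (q i) • erlangLaw (n - i) μ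

/-- The probability that exactly `i` phases of an Erlang variable with `n` phases are over at an
independent random time with law `ρ`. -/
noncomputable def meanWeight (n : ℕ) (μ : ℝ) (ρ : Measure ℝ) (i : ℕ) : ℝ :=
  ∫ u, stepWeight n μ i u ∂ρ

theorem integrable_stepWeight {μ : ℝ} (hμ : 0 < μ) {n i : ℕ} (hi : i ≤ n) (ρ : Measure ℝ)
    [IsProbabilityMeasure ρ] (hρ : ∀ᵐ u ∂ρ, 0 ≤ u) : Integrable (stepWeight n μ i) ρ := by
  refine Integrable.of_bound (measurable_stepWeight n μ i).aestronglyMeasurable 1 ?_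
  filter_upwards [hρ] with u hu
  rw [Real.norm_of_nonneg (stepWeight_nonneg hμ hu n i)]
  exact stepWeight_le_one hμ hu hi

theorem meanWeight_nonneg {μ : ℝ} (hμ : 0 < μ) (n i : ℕ) {ρ : Measure ℝ}
    (hρ : ∀ᵐ u ∂ρ, 0 ≤ u) : 0 ≤ meanWeight n μ ρ i :=
  integral_nonneg_of_ae (hρ.mono fun _ hu => stepWeight_nonneg hμ hu n i)

theorem sum_meanWeight {μ : ℝ} (hμ : 0 < μ) (n : ℕ) (ρ : Measure ℝ)
    [IsProbabilityMeasure ρ] (hρ : ∀ᵐ u ∂ρ, 0 ≤ u) :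
    ∑ i ∈ Finset.range (n + 1), meanWeight n μ ρ i = 1 := by
  simp only [meanWeight]
  rw [← integral_finsetSum _ fun i hi => integrable_stepWeight hμ
    (Nat.lt_succ_iff.1 (Finset.mem_range.1 hi)) ρ hρ]
  simp [sum_stepWeight]

theorem ae_nonneg_conv {ρ ν : Measure ℝ} [SFinite ρ] [SFinite ν] (hρ : ∀ᵐ x ∂ρ, 0 ≤ x)
    (hν : ∀ᵐ x ∂ν, 0 ≤ x) : ∀ᵐ x ∂(ρ ∗ ν), 0 ≤ x := by
  rw [Measure.conv, ae_map_iff (by fun_prop) measurableSet_Ici]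
  filter_upwards [Measure.quasiMeasurePreserving_fst.ae hρ,
    Measure.quasiMeasurePreserving_snd.ae hν] with z h1 h2
  exact add_nonneg h1 h2

/-- The law of `max {0, B - A - W}` is a mixture of Erlang laws, whose weights are the distribution
of the number of phases of `B` that are over at time `A + W`. -/
theorem map_max_sub_sub_eq_erlangMix {n : ℕ} (hn : 1 ≤ n) {μ : ℝ} (hμ : 0 < μ) (ρ ν : Measure ℝ)
    [IsProbabilityMeasure ρ] [IsProbabilityMeasure ν] (hρ : ∀ᵐ x ∂ρ, 0 ≤ x)
    (hν : ∀ᵐ x ∂ν, 0 ≤ x) :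
    (ρ.prod ((erlangLaw n μ).prod ν)).map (fun z : ℝ × ℝ × ℝ => max 0 (z.2.1 - z.1 - z.2.2)) =
      erlangMix n μ (meanWeight n μ (ρ ∗ ν)) := by
  have hprob := isProbabilityMeasure_erlangLaw n hμ
  have hc := ae_nonneg_conv hρ hν
  have hg : Measurable fun z : ℝ × ℝ × ℝ => max 0 (z.2.1 - z.1 - z.2.2) := by fun_prop
  ext s hs
  have hS : MeasurableSet {p : ℝ × ℝ | max 0 (p.2 - p.1) ∈ s} := by
    have : Measurable fun p : ℝ × ℝ => max 0 (p.2 - p.1) := by fun_prop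
    exact this hs
  have hh := measurable_measure_prodMk_left (ν := erlangLaw n μ) hS
  calc (ρ.prod ((erlangLaw n μ).prod ν)).map _ s
      = ∫⁻ a, ∫⁻ w, erlangLaw n μ (Prod.mk (a + w) ⁻¹' {p : ℝ × ℝ | max 0 (p.2 - p.1) ∈ s})
          ∂ν ∂ρ := by
        rw [Measure.map_apply hg hs, Measure.prod_apply (hg hs)]
        refine lintegral_congr fun a => ?_
        rw [Measure.prod_apply_symm (measurable_prodMk_left (hg hs))]
        refine lintegral_congr fun w => ?_
        congr 1
        ext b
        simp [sub_sub]
    _ = ∫⁻ u, erlangLaw n μ (Prod.mk u ⁻¹' {p : ℝ × ℝ | max 0 (p.2 - p.1) ∈ s}) ∂(ρ ∗ ν) :=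
        (Measure.lintegral_conv hh).symm
    _ = ∫⁻ u, ∑ i ∈ Finset.range (n + 1),
          ENNReal.ofReal (stepWeight n μ i u) * erlangLaw (n - i) μ s ∂(ρ ∗ ν) := by
        refine lintegral_congr_ae ?_
        filter_upwards [hc] with u hu
        obtain ⟨m, rfl⟩ : ∃ m, n = m + 1 := ⟨n - 1, by omega⟩
        have h := congrArg (fun κ : Measure ℝ => κ s) (map_erlangLaw_max_sub m hμ hu)
        simp only [Measure.map_apply (show Measurable fun b : ℝ => max 0 (b - u) by fun_prop) hs,
          Measure.coe_finsetSum, Finset.sum_apply, Measure.smul_apply, smul_eq_mul] at h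
        exact h
    _ = erlangMix n μ (meanWeight n μ (ρ ∗ ν)) s := by
        rw [lintegral_finsetSum _ fun i _ =>
          (measurable_stepWeight n μ i).ennreal_ofReal.mul_const _]
        simp only [erlangMix, Measure.coe_finsetSum, Finset.sum_apply, Measure.smul_apply,
          smul_eq_mul]
        refine Finset.sum_congr rfl fun i hi => ?_
        rw [lintegral_mul_const _ (measurable_stepWeight n μ i).ennreal_ofReal, meanWeight,
          ofReal_integral_eq_lintegral_ofReal (integrable_stepWeight hμ
            (Nat.lt_succ_iff.1 (Finset.mem_range.1 hi)) _ hc)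
            (hc.mono fun _ hu => stepWeight_nonneg hμ hu n i)]

/-! ### Laplace transforms and their derivatives -/

/-- The Laplace transform is the moment generating function at `-s`, which makes the results on
analyticity and derivatives of the latter available. -/
theorem laplaceTransform_eq_mgf (ρ : Measure ℝ) :
    laplaceTransform ρ = fun s => mgf id ρ (-s) := by
  funext s; simp [laplaceTransform, mgf]

theorem neg_mem_interior_integrableExpSet (ρ : Measure ℝ) [IsProbabilityMeasure ρ]
    (hρ : ∀ᵐ x ∂ρ, 0 ≤ x) {s : ℝ} (hs : 0 < s) : -s ∈ interior (integrableExpSet id ρ) := by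
  refine mem_interior.2 ⟨Set.Iio 0, fun t ht => ?_, isOpen_Iio, by simpa using hs⟩
  refine Integrable.of_bound (by fun_prop) 1 ?_
  filter_upwards [hρ] with x hx
  rw [Real.norm_of_nonneg (Real.exp_nonneg _)]
  exact Real.exp_le_one_iff.2 (mul_nonpos_of_nonpos_of_nonneg (le_of_lt ht) hx)

theorem contDiffOn_laplaceTransform (ρ : Measure ℝ) [IsProbabilityMeasure ρ]
    (hρ : ∀ᵐ x ∂ρ, 0 ≤ x) : ContDiffOn ℝ ∞ (laplaceTransform ρ) (Set.Ioi 0) := by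
  rw [laplaceTransform_eq_mgf]
  intro s hs
  have h := (analyticAt_mgf (neg_mem_interior_integrableExpSet ρ hρ hs)).contDiffAt (n := ∞)
  exact (h.comp s contDiff_neg.contDiffAt).contDiffWithinAt

theorem contDiffAt_laplaceTransform (ρ : Measure ℝ) [IsProbabilityMeasure ρ]
    (hρ : ∀ᵐ x ∂ρ, 0 ≤ x) {s : ℝ} (hs : 0 < s) (i : ℕ) :
    ContDiffAt ℝ i (laplaceTransform ρ) s :=
  ((contDiffOn_laplaceTransform ρ hρ).contDiffAt (Ioi_mem_nhds hs)).of_le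
    (by exact_mod_cast le_top)

theorem integrable_pow_mul_exp_neg (ρ : Measure ℝ) [IsProbabilityMeasure ρ]
    (hρ : ∀ᵐ x ∂ρ, 0 ≤ x) {s : ℝ} (hs : 0 < s) (i : ℕ) :
    Integrable (fun x => x ^ i * Real.exp (-(s * x))) ρ := by
  simpa using integrable_pow_mul_exp_of_mem_interior_integrableExpSet
    (neg_mem_interior_integrableExpSet ρ hρ hs) i

theorem iteratedDeriv_laplaceTransform (ρ : Measure ℝ) [IsProbabilityMeasure ρ]
    (hρ : ∀ᵐ x ∂ρ, 0 ≤ x) {s : ℝ} (hs : 0 < s) (i : ℕ) :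
    iteratedDeriv i (laplaceTransform ρ) s =
      (-1) ^ i * ∫ x, x ^ i * Real.exp (-(s * x)) ∂ρ := by
  rw [laplaceTransform_eq_mgf, iteratedDeriv_comp_neg,
    iteratedDeriv_mgf (neg_mem_interior_integrableExpSet ρ hρ hs)]
  simp

theorem laplaceTransform_pos (ρ : Measure ℝ) [IsProbabilityMeasure ρ]
    (hρ : ∀ᵐ x ∂ρ, 0 ≤ x) {s : ℝ} (hs : 0 < s) : 0 < laplaceTransform ρ s := by
  have h := integrable_pow_mul_exp_neg ρ hρ hs 0
  simp only [pow_zero, one_mul] at h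
  exact integral_exp_pos h

theorem laplaceTransform_conv (ρ ν : Measure ℝ) [IsProbabilityMeasure ρ]
    [IsProbabilityMeasure ν] (hρ : ∀ᵐ x ∂ρ, 0 ≤ x) (hν : ∀ᵐ x ∂ν, 0 ≤ x) {s : ℝ} (hs : 0 < s) :
    laplaceTransform (ρ ∗ ν) s = laplaceTransform ν s * laplaceTransform ρ s := by
  have h := integrable_pow_mul_exp_neg _ (ae_nonneg_conv hρ hν) hs 0
  simp only [pow_zero, one_mul] at h
  rw [laplaceTransform, integral_conv h]
  simp only [mul_add, neg_add, Real.exp_add, integral_const_mul, integral_mul_const]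
  rw [mul_comm]
  rfl

theorem iteratedDeriv_laplaceTransform_mul (ρ ν : Measure ℝ) [IsProbabilityMeasure ρ]
    [IsProbabilityMeasure ν] (hρ : ∀ᵐ x ∂ρ, 0 ≤ x) (hν : ∀ᵐ x ∂ν, 0 ≤ x) {s : ℝ} (hs : 0 < s)
    (i : ℕ) :
    iteratedDeriv i (fun s => laplaceTransform ν s * laplaceTransform ρ s) s =
      ∑ k ∈ Finset.range (i + 1), (i.choose k : ℝ) * iteratedDeriv k (laplaceTransform ν) s *
        iteratedDeriv (i - k) (laplaceTransform ρ) s :=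
  iteratedDeriv_fun_mul (contDiffAt_laplaceTransform ν hν hs i)
    (contDiffAt_laplaceTransform ρ hρ hs i)

/-- The two functions agree only at positive arguments, where the integrals converge; this is
enough for the derivatives at `s > 0`. -/
theorem iteratedDeriv_laplaceTransform_conv (ρ ν : Measure ℝ) [IsProbabilityMeasure ρ]
    [IsProbabilityMeasure ν] (hρ : ∀ᵐ x ∂ρ, 0 ≤ x) (hν : ∀ᵐ x ∂ν, 0 ≤ x) {s : ℝ} (hs : 0 < s)
    (i : ℕ) :
    iteratedDeriv i (laplaceTransform (ρ ∗ ν)) s =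
      iteratedDeriv i (fun s => laplaceTransform ν s * laplaceTransform ρ s) s := by
  refine Filter.EventuallyEq.iteratedDeriv_eq i ?_
  filter_upwards [Ioi_mem_nhds hs] with t ht
  exact laplaceTransform_conv ρ ν hρ hν ht

/-- The mean Poisson weight `E[(μ U)^i / i! e^{-μ U}]` is a derivative at `μ` of the Laplace
transform of `U`. -/
theorem meanWeight_of_lt {n i : ℕ} (hi : i < n) {μ : ℝ} (hμ : 0 < μ) (ρ : Measure ℝ)
    [IsProbabilityMeasure ρ] (hρ : ∀ᵐ x ∂ρ, 0 ≤ x) :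
    meanWeight n μ ρ i = (-μ) ^ i / i ! * iteratedDeriv i (laplaceTransform ρ) μ := by
  rw [iteratedDeriv_laplaceTransform ρ hρ hμ, meanWeight, stepWeight_of_lt μ hi, ← mul_assoc,
    ← integral_const_mul]
  refine integral_congr_ae (ae_of_all _ fun u => ?_)
  have h : (-1 : ℝ) ^ i * (-1) ^ i = 1 := by rw [← mul_pow]; simp
  simp only [poissonWeight]
  rw [neg_pow μ, mul_pow]
  linear_combination -(μ ^ i * u ^ i / i ! * Real.exp (-(μ * u))) * h

theorem iteratedDeriv_laplaceTransform_dirac_zero (s : ℝ) (l : ℕ) :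
    iteratedDeriv l (laplaceTransform (Measure.dirac 0)) s = if l = 0 then 1 else 0 := by
  have h : laplaceTransform (Measure.dirac 0) = fun _ => 1 := by
    funext t; simp [laplaceTransform]
  rw [h, iteratedDeriv_const]

theorem iteratedDeriv_laplaceTransform_erlangLaw_succ (m : ℕ) {μ : ℝ} (hμ : 0 < μ) (l : ℕ) :
    iteratedDeriv l (laplaceTransform (erlangLaw (m + 1) μ)) μ =
      (-1) ^ l * ((l + m)! / m ! * (μ ^ (m + 1) / (2 * μ) ^ (l + m + 1))) := by
  have := isProbabilityMeasure_erlangLaw (m + 1) hμ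
  rw [iteratedDeriv_laplaceTransform _ (ae_nonneg_erlangLaw _ hμ) hμ]
  congr 1
  rw [erlangLaw_eq_withDensity m hμ, integral_withDensity_eq_integral_toReal_smul
    (measurable_erlangPDF m μ).ennreal_ofReal (by simp)]
  have h : ∀ x, (ENNReal.ofReal (erlangPDF m μ x)).toReal • (x ^ l * Real.exp (-(μ * x))) =
      (Set.Ici 0).indicator (fun x => μ ^ (m + 1) / m ! *
        (x ^ (((l + m : ℕ) : ℝ) + 1 - 1) * Real.exp (-(2 * μ * x)))) x := by
    intro x
    rw [ENNReal.toReal_ofReal (erlangPDF_nonneg m hμ x), erlangPDF, smul_eq_mul]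
    by_cases hx : 0 ≤ x
    · rw [if_pos hx, Set.indicator_of_mem (Set.mem_Ici.2 hx), add_sub_cancel_right,
        Real.rpow_natCast, show -(2 * μ * x) = -(μ * x) + -(μ * x) by ring, Real.exp_add, pow_add]
      ring
    · simp [hx]
  simp_rw [h]
  rw [integral_indicator measurableSet_Ici, integral_Ici_eq_integral_Ioi, integral_const_mul,
    Real.integral_rpow_mul_exp_neg_mul_Ioi (by positivity) (by positivity),
    Real.Gamma_nat_eq_factorial, ← Nat.cast_succ, Real.rpow_natCast, div_pow, one_pow]
  simp only [Nat.succ_eq_add_one]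
  ring

theorem iteratedDeriv_laplaceTransform_erlangMix (n : ℕ) {μ : ℝ} (hμ : 0 < μ) {q : ℕ → ℝ}
    (hq : ∀ i, 0 ≤ q i) [IsProbabilityMeasure (erlangMix n μ q)]
    (hae : ∀ᵐ x ∂erlangMix n μ q, 0 ≤ x) (l : ℕ) :
    iteratedDeriv l (laplaceTransform (erlangMix n μ q)) μ =
      ∑ i ∈ Finset.range (n + 1),
        q i * iteratedDeriv l (laplaceTransform (erlangLaw (n - i) μ)) μ := by
  have hprob := fun n => isProbabilityMeasure_erlangLaw n hμ
  rw [iteratedDeriv_laplaceTransform _ hae hμ, erlangMix, integral_finsetSum_measure]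
  · rw [Finset.mul_sum]
    refine Finset.sum_congr rfl fun i _ => ?_
    rw [integral_smul_measure, ENNReal.toReal_ofReal (hq i), smul_eq_mul,
      iteratedDeriv_laplaceTransform _ (ae_nonneg_erlangLaw _ hμ) hμ]
    ring
  · intro i _
    exact (integrable_pow_mul_exp_neg _ (ae_nonneg_erlangLaw _ hμ) hμ l).smul_measure
      ENNReal.ofReal_ne_top

theorem isProbabilityMeasure_erlangMix (n : ℕ) {μ : ℝ} (hμ : 0 < μ) {q : ℕ → ℝ}
    (hq : ∀ i, 0 ≤ q i) (hq1 : ∑ i ∈ Finset.range (n + 1), q i = 1) :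
    IsProbabilityMeasure (erlangMix n μ q) := by
  have hprob := fun n => isProbabilityMeasure_erlangLaw n hμ
  constructor
  simp only [erlangMix, Measure.coe_finsetSum, Finset.sum_apply, Measure.smul_apply, measure_univ,
    smul_eq_mul, mul_one]
  rw [← ENNReal.ofReal_sum_of_nonneg fun i _ => hq i, hq1, ENNReal.ofReal_one]

theorem ae_nonneg_erlangMix (n : ℕ) {μ : ℝ} (hμ : 0 < μ) (q : ℕ → ℝ) :
    ∀ᵐ x ∂erlangMix n μ q, 0 ≤ x := by
  have h : ∀ i, erlangLaw i μ {x | ¬ 0 ≤ x} = 0 := fun i => ae_iff.1 (ae_nonneg_erlangLaw i hμ)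
  simp [ae_iff, erlangMix] at h ⊢
  simp [h]

theorem erlangMix_congr {n : ℕ} (μ : ℝ) {q r : ℕ → ℝ} (h : ∀ i ≤ n, q i = r i) :
    erlangMix n μ q = erlangMix n μ r :=
  Finset.sum_congr rfl fun i hi => by rw [h i (Nat.lt_succ_iff.1 (Finset.mem_range.1 hi))]

/-! ### The linear system -/

/-- The weights `i ≤ n` that are computed from the derivatives `a` and `y` at `μ` of the Laplace
transforms of `A` and `W`; for actual transforms they are the distribution of the number of
phases of an Erlang variable that are over at time `A + W`. -/
noncomputable def balanceWeight (n : ℕ) (μ : ℝ) (a y : ℕ → ℝ) (i : ℕ) : ℝ :=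
  if i < n then (-μ) ^ i * ∑ k ∈ Finset.range (i + 1), y k * a (i - k) / (k ! * (i - k)! : ℝ)
  else 1 - ∑ j ∈ Finset.range n,
    (-μ) ^ j * ∑ k ∈ Finset.range (j + 1), y k * a (j - k) / (k ! * (j - k)! : ℝ)

theorem balanceWeight_of_lt {n i : ℕ} (hi : i < n) (μ : ℝ) (a y : ℕ → ℝ) :
    balanceWeight n μ a y i =
      (-μ) ^ i * ∑ k ∈ Finset.range (i + 1), y k * a (i - k) / (k ! * (i - k)! : ℝ) := by
  simp [balanceWeight, hi]

theorem balanceWeight_self (n : ℕ) (μ : ℝ) (a y : ℕ → ℝ) :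
    balanceWeight n μ a y n = 1 - ∑ j ∈ Finset.range n, balanceWeight n μ a y j := by
  rw [balanceWeight, if_neg (lt_irrefl n)]
  congr 1
  exact Finset.sum_congr rfl fun j hj => (balanceWeight_of_lt (Finset.mem_range.1 hj) μ a y).symm

theorem sum_balanceWeight (n : ℕ) (μ : ℝ) (a y : ℕ → ℝ) :
    ∑ i ∈ Finset.range (n + 1), balanceWeight n μ a y i = 1 := by
  rw [Finset.sum_range_succ, balanceWeight_self]
  ring

theorem balanceWeight_congr {n : ℕ} (μ : ℝ) (a : ℕ → ℝ) {y z : ℕ → ℝ} (h : ∀ l < n, y l = z l)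
    {i : ℕ} (hi : i ≤ n) : balanceWeight n μ a y i = balanceWeight n μ a z i := by
  have hlt : ∀ j < n, balanceWeight n μ a y j = balanceWeight n μ a z j := by
    intro j hj
    rw [balanceWeight_of_lt hj, balanceWeight_of_lt hj]
    congr 1
    refine Finset.sum_congr rfl fun k hk => ?_
    rw [h k (by have := Finset.mem_range.1 hk; omega)]
  rcases hi.lt_or_eq with hi | rfl
  · exact hlt i hi
  · rw [balanceWeight_self, balanceWeight_self]
    congr 1
    exact Finset.sum_congr rfl fun j hj => hlt j (Finset.mem_range.1 hj)

theorem meanWeight_conv {n i : ℕ} (hi : i ≤ n) {μ : ℝ} (hμ : 0 < μ) (ρ ν : Measure ℝ)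
    [IsProbabilityMeasure ρ] [IsProbabilityMeasure ν] (hρ : ∀ᵐ x ∂ρ, 0 ≤ x)
    (hν : ∀ᵐ x ∂ν, 0 ≤ x) :
    meanWeight n μ (ρ ∗ ν) i = balanceWeight n μ
      (fun j => iteratedDeriv j (laplaceTransform ρ) μ)
      (fun k => iteratedDeriv k (laplaceTransform ν) μ) i := by
  have hc := ae_nonneg_conv hρ hν
  have hlt : ∀ j < n, meanWeight n μ (ρ ∗ ν) j = balanceWeight n μ
      (fun j => iteratedDeriv j (laplaceTransform ρ) μ)
      (fun k => iteratedDeriv k (laplaceTransform ν) μ) j := by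
    intro j hj
    rw [meanWeight_of_lt hj hμ _ hc, balanceWeight_of_lt hj,
      iteratedDeriv_laplaceTransform_conv ρ ν hρ hν hμ,
      iteratedDeriv_laplaceTransform_mul ρ ν hρ hν hμ, div_mul_eq_mul_div, mul_div_assoc,
      Finset.sum_div]
    congr 1
    refine Finset.sum_congr rfl fun k hk => ?_
    rw [Nat.cast_choose ℝ (Nat.lt_succ_iff.1 (Finset.mem_range.1 hk))]
    have := (Nat.factorial_pos j).ne'
    field_simp
  rcases hi.lt_or_eq with hi | rfl
  · exact hlt i hi
  · have h := sum_meanWeight hμ i (ρ ∗ ν) hc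
    rw [Finset.sum_range_succ, Finset.sum_congr rfl fun j hj => hlt j (Finset.mem_range.1 hj)] at h
    rw [balanceWeight_self]
    linarith

/-- The linear system says that `y` consists of the derivatives of the Laplace transform of the
(possibly signed) mixture of Erlang laws whose weights are computed from `y`. -/
theorem solvesBalanceSystem_iff {n : ℕ} (hn : 1 ≤ n) {μ : ℝ} (hμ : 0 < μ) (a y : ℕ → ℝ) :
    SolvesBalanceSystem n μ a y ↔ ∀ l < n, y l = ∑ i ∈ Finset.range (n + 1),
      balanceWeight n μ a y i * iteratedDeriv l (laplaceTransform (erlangLaw (n - i) μ)) μ := by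
  set S : ℕ → ℝ := fun i => ∑ k ∈ Finset.range (i + 1), y k * a (i - k) / (k ! * (i - k)! : ℝ)
    with hS
  have hw : ∀ i ∈ Finset.range n, balanceWeight n μ a y i = (-μ) ^ i * S i := fun i hi =>
    balanceWeight_of_lt (Finset.mem_range.1 hi) μ a y
  have h0 : ∑ i ∈ Finset.range (n + 1),
        balanceWeight n μ a y i * iteratedDeriv 0 (laplaceTransform (erlangLaw (n - i) μ)) μ =
      1 - ∑ i ∈ Finset.range n, (-μ) ^ i * (1 - 1 / 2 ^ (n - i)) * S i := by
    rw [Finset.sum_range_succ, Nat.sub_self, erlangLaw_zero,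
      iteratedDeriv_laplaceTransform_dirac_zero, if_pos rfl, mul_one, balanceWeight_self,
      add_comm, sub_add, ← Finset.sum_sub_distrib]
    congr 1
    refine Finset.sum_congr rfl fun i hi => ?_
    have hin := Finset.mem_range.1 hi
    obtain ⟨m, hm⟩ : ∃ m, n - i = m + 1 := ⟨n - i - 1, by omega⟩
    rw [hw i hi, hm, iteratedDeriv_laplaceTransform_erlangLaw_succ m hμ, zero_add, mul_pow]
    have := (Nat.factorial_pos m).ne'
    field_simp
  have hl : ∀ l, 1 ≤ l → ∑ i ∈ Finset.range (n + 1),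
        balanceWeight n μ a y i * iteratedDeriv l (laplaceTransform (erlangLaw (n - i) μ)) μ =
      ∑ i ∈ Finset.range n, μ ^ ((i : ℤ) - (l : ℤ)) * ((-1) ^ (i + l) / 2 ^ (n - i + l)) *
        (((n - i + l - 1)! : ℝ) / ((n - i - 1)! : ℝ)) * S i := by
    intro l hl
    rw [Finset.sum_range_succ, Nat.sub_self, erlangLaw_zero,
      iteratedDeriv_laplaceTransform_dirac_zero, if_neg (by omega), mul_zero, add_zero]
    refine Finset.sum_congr rfl fun i hi => ?_
    have hin := Finset.mem_range.1 hi
    obtain ⟨m, hm⟩ : ∃ m, n - i = m + 1 := ⟨n - i - 1, by omega⟩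
    rw [hw i hi, hm, iteratedDeriv_laplaceTransform_erlangLaw_succ m hμ, zpow_sub₀ hμ.ne',
      zpow_natCast, zpow_natCast, show m + 1 + l - 1 = l + m by omega, Nat.add_sub_cancel,
      mul_pow, neg_pow μ]
    field_simp
    ring
  constructor
  · rintro ⟨h1, h2⟩ l hln
    rcases Nat.eq_zero_or_pos l with rfl | hpos
    · rw [h0]; exact h1
    · rw [hl l hpos]; exact h2 l hpos hln
  · intro h
    exact ⟨(h 0 hn).trans h0, fun l hpos hln => (h l hln).trans (hl l hpos)⟩

/-! ### The Markov chain of phases -/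

/-- The transition matrix of the number of completed phases: if `W` is an Erlang variable with
`n - j` phases, then `max {0, B - A - W}` has `n - i` phases with probability
`phaseMatrix n μ ρ j i`, where `ρ` is the law of `A`. -/
noncomputable def phaseMatrix (n : ℕ) (μ : ℝ) (ρ : Measure ℝ) :
    Matrix (Fin (n + 1)) (Fin (n + 1)) ℝ :=
  fun j i => meanWeight n μ (ρ ∗ erlangLaw (n - j) μ) i

section PhaseMatrix

variable {n : ℕ} {μ : ℝ} (ρ : Measure ℝ) [IsProbabilityMeasure ρ]

theorem phaseMatrix_nonneg (hμ : 0 < μ) (hρ : ∀ᵐ x ∂ρ, 0 ≤ x) (j i : Fin (n + 1)) :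
    0 ≤ phaseMatrix n μ ρ j i := by
  have := isProbabilityMeasure_erlangLaw (n - j) hμ
  exact meanWeight_nonneg hμ n i (ae_nonneg_conv hρ (ae_nonneg_erlangLaw _ hμ))

theorem sum_phaseMatrix (hμ : 0 < μ) (hρ : ∀ᵐ x ∂ρ, 0 ≤ x) (j : Fin (n + 1)) :
    ∑ i, phaseMatrix n μ ρ j i = 1 := by
  have := isProbabilityMeasure_erlangLaw (n - j) hμ
  rw [← sum_meanWeight hμ n _ (ae_nonneg_conv hρ (ae_nonneg_erlangLaw (n - j) hμ)),
    Finset.sum_range]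
  rfl

/-- From every state no phase at all may be completed, since `E[e^{-μ(A + W)}] > 0`. -/
theorem phaseMatrix_zero_pos (hn : 1 ≤ n) (hμ : 0 < μ) (hρ : ∀ᵐ x ∂ρ, 0 ≤ x) (j : Fin (n + 1)) :
    0 < phaseMatrix n μ ρ j 0 := by
  have := isProbabilityMeasure_erlangLaw (n - j) hμ
  have hc := ae_nonneg_conv hρ (ae_nonneg_erlangLaw (n - j) hμ)
  have h := meanWeight_of_lt (i := 0) (n := n) hn hμ _ hc
  rw [phaseMatrix, Fin.val_zero, h]
  simpa using laplaceTransform_pos _ hc hμ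

theorem balanceWeight_eq_sum_phaseMatrix (hμ : 0 < μ) (hρ : ∀ᵐ x ∂ρ, 0 ≤ x) {q y : ℕ → ℝ}
    (hq : ∑ j ∈ Finset.range (n + 1), q j = 1)
    (hy : ∀ l < n, y l = ∑ j ∈ Finset.range (n + 1),
      q j * iteratedDeriv l (laplaceTransform (erlangLaw (n - j) μ)) μ) (i : Fin (n + 1)) :
    balanceWeight n μ (fun j => iteratedDeriv j (laplaceTransform ρ) μ) y i =
      ∑ j : Fin (n + 1), q j * phaseMatrix n μ ρ j i := by
  have hprob := fun n => isProbabilityMeasure_erlangLaw n hμ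
  have hae := fun n => ae_nonneg_erlangLaw n hμ
  have hM : ∀ j i : Fin (n + 1), phaseMatrix n μ ρ j i = balanceWeight n μ
      (fun j => iteratedDeriv j (laplaceTransform ρ) μ)
      (fun k => iteratedDeriv k (laplaceTransform (erlangLaw (n - j) μ)) μ) i := fun j i =>
    meanWeight_conv (Nat.lt_succ_iff.1 i.2) hμ ρ (erlangLaw (n - j) μ) hρ (hae _)
  have hlt : ∀ i : Fin (n + 1), (i : ℕ) < n →
      balanceWeight n μ (fun j => iteratedDeriv j (laplaceTransform ρ) μ) y i =
        ∑ j : Fin (n + 1), q j * phaseMatrix n μ ρ j i := by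
    intro i hi
    simp only [hM]
    rw [← Finset.sum_range fun j => q j * balanceWeight n μ
      (fun j => iteratedDeriv j (laplaceTransform ρ) μ)
      (fun k => iteratedDeriv k (laplaceTransform (erlangLaw (n - j) μ)) μ) i]
    simp only [balanceWeight_of_lt hi, mul_left_comm _ ((-μ) ^ (i : ℕ)), ← Finset.mul_sum]
    congr 1
    simp only [Finset.mul_sum]
    rw [Finset.sum_comm]
    refine Finset.sum_congr rfl fun k hk => ?_
    rw [hy k (by have := Finset.mem_range.1 hk; omega), Finset.sum_mul, Finset.sum_div]
    exact Finset.sum_congr rfl fun j _ => by ring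
  rcases (Nat.lt_succ_iff.1 i.2).lt_or_eq with hi | hi
  · exact hlt i hi
  · -- both sides sum to one over all states
    obtain rfl : i = Fin.last n := Fin.ext hi
    have h1 := sum_balanceWeight n μ (fun j => iteratedDeriv j (laplaceTransform ρ) μ) y
    have h2 : ∑ i : Fin (n + 1), ∑ j : Fin (n + 1), q j * phaseMatrix n μ ρ j i = 1 := by
      rw [Finset.sum_comm]
      simp only [← Finset.mul_sum, sum_phaseMatrix ρ hμ hρ, mul_one]
      rw [← Finset.sum_range, hq]
    rw [Finset.sum_range, Fin.sum_univ_castSucc] at h1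
    rw [Fin.sum_univ_castSucc, ← Finset.sum_congr rfl fun i _ => hlt (Fin.castSucc i) i.2] at h2
    linarith

/-- The solution is unique among all real sequences, not only among the derivatives of Laplace
transforms: the weights of two solutions may be negative, but their difference is a fixed vector
of sum zero of the chain of phases. -/
theorem SolvesBalanceSystem.unique (hn : 1 ≤ n) (hμ : 0 < μ) (hρ : ∀ᵐ x ∂ρ, 0 ≤ x) {y z : ℕ → ℝ}
    (hy : SolvesBalanceSystem n μ (fun j => iteratedDeriv j (laplaceTransform ρ) μ) y)
    (hz : SolvesBalanceSystem n μ (fun j => iteratedDeriv j (laplaceTransform ρ) μ) z) :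
    ∀ l < n, y l = z l := by
  rw [solvesBalanceSystem_iff hn hμ] at hy hz
  set a : ℕ → ℝ := fun j => iteratedDeriv j (laplaceTransform ρ) μ
  -- the weights of `y` and of `z` are both fixed by the chain and sum to one
  have hzero := eq_zero_of_vecMul_eq_self (phaseMatrix_nonneg ρ hμ hρ) (sum_phaseMatrix ρ hμ hρ) 0
    (phaseMatrix_zero_pos ρ hn hμ hρ)
    (v := fun i => balanceWeight n μ a y i - balanceWeight n μ a z i)
    (fun i => by
      simp only [sub_mul, Finset.sum_sub_distrib]
      rw [← balanceWeight_eq_sum_phaseMatrix ρ hμ hρ (sum_balanceWeight n μ a y) hy,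
        ← balanceWeight_eq_sum_phaseMatrix ρ hμ hρ (sum_balanceWeight n μ a z) hz])
    (by
      rw [Finset.sum_sub_distrib, ← Finset.sum_range, ← Finset.sum_range, sum_balanceWeight,
        sum_balanceWeight, sub_self])
  intro l hl
  rw [hy l hl, hz l hl]
  refine Finset.sum_congr rfl fun i hi => ?_
  have h := congrFun hzero ⟨i, Finset.mem_range.1 hi⟩
  simp only [Pi.zero_apply, sub_eq_zero] at h
  rw [h]

/-! ### Stationary laws -/

theorem IsStationaryLaw.ae_nonneg {ρ σ ν : Measure ℝ} (h : IsStationaryLaw ρ σ ν) :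
    ∀ᵐ x ∂ν, 0 ≤ x := by
  rw [← h.2, ae_map_iff (by fun_prop) measurableSet_Ici]
  exact ae_of_all _ fun z => le_max_left _ _

theorem IsStationaryLaw.eq_erlangMix (hn : 1 ≤ n) (hμ : 0 < μ) (hρ : ∀ᵐ x ∂ρ, 0 ≤ x)
    {ν : Measure ℝ} (h : IsStationaryLaw ρ (erlangLaw n μ) ν) :
    ν = erlangMix n μ (meanWeight n μ (ρ ∗ ν)) := by
  have := h.1
  rw [← map_max_sub_sub_eq_erlangMix hn hμ ρ ν hρ h.ae_nonneg, h.2]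

theorem IsStationaryLaw.solvesBalanceSystem (hn : 1 ≤ n) (hμ : 0 < μ) (hρ : ∀ᵐ x ∂ρ, 0 ≤ x)
    {ν : Measure ℝ} (h : IsStationaryLaw ρ (erlangLaw n μ) ν) :
    SolvesBalanceSystem n μ (fun j => iteratedDeriv j (laplaceTransform ρ) μ)
      (fun k => iteratedDeriv k (laplaceTransform ν) μ) := by
  have hν := h.1
  have hae := h.ae_nonneg
  have heq := h.eq_erlangMix ρ hn hμ hρ
  have hq := fun i => meanWeight_nonneg hμ n i (ae_nonneg_conv hρ hae)
  rw [solvesBalanceSystem_iff hn hμ]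
  intro l _
  have hprob : IsProbabilityMeasure (erlangMix n μ (meanWeight n μ (ρ ∗ ν))) := heq ▸ hν
  have hmix := iteratedDeriv_laplaceTransform_erlangMix n hμ hq (ae_nonneg_erlangMix n hμ _) l
  rw [← heq] at hmix
  rw [hmix]
  refine Finset.sum_congr rfl fun i hi => ?_
  rw [meanWeight_conv (Nat.lt_succ_iff.1 (Finset.mem_range.1 hi)) hμ ρ ν hρ hae]

theorem existsUnique_isStationaryLaw (hn : 1 ≤ n) (hμ : 0 < μ) (hρ : ∀ᵐ x ∂ρ, 0 ≤ x) :
    ∃! ν : Measure ℝ, IsStationaryLaw ρ (erlangLaw n μ) ν := by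
  refine existsUnique_of_exists_of_unique ?_ ?_
  · obtain ⟨q, hq0, hq1, hq⟩ :=
      exists_stationary_vector (phaseMatrix_nonneg ρ hμ hρ) (sum_phaseMatrix (n := n) ρ hμ hρ)
    -- the stationary vector, continued by zero to all natural numbers
    set r : ℕ → ℝ := fun i => if h : i < n + 1 then q ⟨i, h⟩ else 0 with hr
    have hrq : ∀ i : Fin (n + 1), r i = q i := fun i => dif_pos i.2
    have hr0 : ∀ i, 0 ≤ r i := by
      intro i
      simp only [hr]
      split_ifs
      exacts [hq0 _, le_rfl]
    have hr1 : ∑ i ∈ Finset.range (n + 1), r i = 1 := by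
      rw [Finset.sum_range, Finset.sum_congr rfl fun i _ => hrq i, hq1]
    have hprob := isProbabilityMeasure_erlangMix n hμ hr0 hr1
    have hae := ae_nonneg_erlangMix n hμ r
    refine ⟨erlangMix n μ r, hprob, ?_⟩
    rw [map_max_sub_sub_eq_erlangMix hn hμ ρ _ hρ hae]
    refine erlangMix_congr μ fun i hi => ?_
    have hbal := balanceWeight_eq_sum_phaseMatrix ρ hμ hρ hr1
      (fun l _ => iteratedDeriv_laplaceTransform_erlangMix n hμ hr0 hae l)
      ⟨i, Nat.lt_succ_iff.2 hi⟩
    rw [meanWeight_conv hi hμ ρ _ hρ hae]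
    refine hbal.trans ?_
    simp only [hrq]
    rw [← hq, ← hrq]
  · intro ν κ hν hκ
    have := hν.1
    have := hκ.1
    rw [hν.eq_erlangMix ρ hn hμ hρ, hκ.eq_erlangMix ρ hn hμ hρ]
    refine erlangMix_congr μ fun i hi => ?_
    rw [meanWeight_conv hi hμ ρ ν hρ hν.ae_nonneg, meanWeight_conv hi hμ ρ κ hρ hκ.ae_nonneg]
    exact balanceWeight_congr μ _ (SolvesBalanceSystem.unique ρ hn hμ hρ
      (hν.solvesBalanceSystem ρ hn hμ hρ) (hκ.solvesBalanceSystem ρ hn hμ hρ)) hi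

end PhaseMatrix

/-! ### The density and the mass at the origin -/

theorem sum_mul_erlangPDF (n : ℕ) (μ : ℝ) (c : ℕ → ℝ) {x : ℝ} (hx : 0 ≤ x) :
    μ ^ n * Real.exp (-(μ * x)) * ∑ i ∈ Finset.range n, c i * (x ^ (n - 1 - i) / (n - 1 - i)!) =
      ∑ i ∈ Finset.range n, μ ^ i * c i * erlangPDF (n - 1 - i) μ x := by
  rw [Finset.mul_sum]
  refine Finset.sum_congr rfl fun i hi => ?_
  have hin := Finset.mem_range.1 hi
  have hpow : μ ^ n = μ ^ i * μ ^ (n - 1 - i + 1) := by rw [← pow_add]; congr 1; omega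
  rw [erlangPDF, if_pos hx, hpow]
  ring

theorem erlangMix_eq_dirac_add_withDensity (n : ℕ) {μ : ℝ} (hμ : 0 < μ) {q : ℕ → ℝ}
    (hq : ∀ i, 0 ≤ q i) {f : ℝ → ℝ}
    (hf : ∀ x, 0 ≤ x → f x = ∑ i ∈ Finset.range n, q i * erlangPDF (n - 1 - i) μ x) :
    erlangMix n μ q = ENNReal.ofReal (q n) • Measure.dirac 0 +
      (volume.restrict (Set.Ici 0)).withDensity fun x => ENNReal.ofReal (f x) := by
  rw [erlangMix, Finset.sum_range_succ, Nat.sub_self, erlangLaw_zero, add_comm]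
  congr 1
  ext s hs
  rw [withDensity_apply _ hs, Measure.restrict_restrict hs,
    ← lintegral_indicator (hs.inter measurableSet_Ici)]
  have hterm : ∀ i ∈ Finset.range n, (ENNReal.ofReal (q i) • erlangLaw (n - i) μ) s =
      ∫⁻ x, s.indicator (fun x => ENNReal.ofReal (q i) *
        ENNReal.ofReal (erlangPDF (n - 1 - i) μ x)) x := by
    intro i hi
    have hin := Finset.mem_range.1 hi
    rw [show n - i = (n - 1 - i) + 1 by omega, erlangLaw_eq_withDensity _ hμ,
      Measure.smul_apply, smul_eq_mul, withDensity_apply _ hs, lintegral_indicator hs,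
      lintegral_const_mul _ (measurable_erlangPDF _ μ).ennreal_ofReal]
  rw [Measure.coe_finsetSum, Finset.sum_apply, Finset.sum_congr rfl hterm,
    ← lintegral_finsetSum _ fun i _ =>
      (((measurable_erlangPDF _ μ).ennreal_ofReal.const_mul _).indicator hs)]
  refine lintegral_congr fun x => ?_
  by_cases hx : 0 ≤ x
  · by_cases hxs : x ∈ s
    · rw [Set.indicator_of_mem (show x ∈ s ∩ Set.Ici 0 from ⟨hxs, hx⟩), hf x hx,
        ENNReal.ofReal_sum_of_nonneg fun i _ => mul_nonneg (hq i) (erlangPDF_nonneg _ hμ x)]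
      refine Finset.sum_congr rfl fun i _ => ?_
      rw [Set.indicator_of_mem hxs, ENNReal.ofReal_mul (hq i)]
    · simp [hxs]
  · rw [Set.indicator_of_notMem fun h => hx h.2]
    exact Finset.sum_eq_zero fun i _ => by simp [erlangPDF, hx]

/-- An Erlang variable with at least one phase differs almost surely from `A + W`. -/
theorem prod_erlangLaw_prod_eq_zero {n : ℕ} (hn : 1 ≤ n) {μ : ℝ} (hμ : 0 < μ) (ρ ν : Measure ℝ)
    [IsProbabilityMeasure ρ] [IsProbabilityMeasure ν] :
    (ρ.prod ((erlangLaw n μ).prod ν)) {z : ℝ × ℝ × ℝ | z.2.1 = z.2.2 + z.1} = 0 := by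
  have := isProbabilityMeasure_erlangLaw n hμ
  have hS : MeasurableSet {z : ℝ × ℝ × ℝ | z.2.1 = z.2.2 + z.1} :=
    measurableSet_eq_fun (by fun_prop) (by fun_prop)
  rw [Measure.measure_prod_null hS]
  refine ae_of_all _ fun a => ?_
  change ((erlangLaw n μ).prod ν) (Prod.mk a ⁻¹' _) = 0
  rw [Measure.prod_apply_symm (measurable_prodMk_left hS)]
  refine lintegral_eq_zero_of_ae_eq_zero (ae_of_all _ fun w => ?_)
  obtain ⟨m, rfl⟩ : ∃ m, n = m + 1 := ⟨n - 1, by omega⟩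
  exact erlangLaw_singleton m hμ (w + a)

theorem map_prodMk_of_iIndepFun {Ω : Type*} [MeasurableSpace Ω] {P : Measure Ω}
    [IsProbabilityMeasure P] {A B W : Ω → ℝ} (hA : AEMeasurable A P) (hB : AEMeasurable B P)
    (hW : AEMeasurable W P) (h : iIndepFun ![A, B, W] P) :
    P.map (fun t => (A t, B t, W t)) = (P.map A).prod ((P.map B).prod (P.map W)) := by
  have hm : ∀ i, AEMeasurable (![A, B, W] i) P := by
    intro i
    fin_cases i
    exacts [hA, hB, hW]
  have h1 : IndepFun B W P := h.indepFun (i := 1) (j := 2) (by decide)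
  have h2 : IndepFun A (fun t => (B t, W t)) P :=
    (h.indepFun_prodMk₀ hm 1 2 0 (by decide) (by decide)).symm
  rw [(indepFun_iff_map_prod_eq_prod_map_map hA (hB.prodMk hW)).1 h2,
    (indepFun_iff_map_prod_eq_prod_map_map hB hW).1 h1]

theorem isStationaryLaw_of_identDistrib {Ω : Type*} [MeasurableSpace Ω] {P : Measure Ω}
    [IsProbabilityMeasure P] {A B W : Ω → ℝ} {ρ σ : Measure ℝ} (hA : HasLaw A ρ P)
    (hB : HasLaw B σ P) (h : iIndepFun ![A, B, W] P)
    (hW : IdentDistrib W (fun t => max 0 (B t - A t - W t)) P P) :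
    IsStationaryLaw ρ σ (P.map W) := by
  have hWm := hW.aemeasurable_fst
  refine ⟨Measure.isProbabilityMeasure_map hWm, ?_⟩
  have hJ := map_prodMk_of_iIndepFun hA.aemeasurable hB.aemeasurable hWm h
  rw [hA.map_eq, hB.map_eq] at hJ
  rw [← hJ, AEMeasurable.map_map_of_aemeasurable (by fun_prop)
    (hA.aemeasurable.prodMk (hB.aemeasurable.prodMk hWm)), hW.map_eq]
  rfl

/-- The events `W = 0` and `B < W + A` have the same probability, since the law of `W`
is stationary and the tie `B = W + A` has probability zero. -/
theorem measure_eq_zero_eq_measure_lt {Ω : Type*} [MeasurableSpace Ω] {P : Measure Ω}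
    [IsProbabilityMeasure P] {A B W : Ω → ℝ} {n : ℕ} (hn : 1 ≤ n) {μ : ℝ} (hμ : 0 < μ)
    {ρ : Measure ℝ} [IsProbabilityMeasure ρ] (hA : HasLaw A ρ P)
    (hB : HasLaw B (erlangLaw n μ) P) (h : iIndepFun ![A, B, W] P)
    (hW : IdentDistrib W (fun t => max 0 (B t - A t - W t)) P P) :
    P {t | W t = 0} = P {t | B t < W t + A t} := by
  have hWm := hW.aemeasurable_fst
  have := Measure.isProbabilityMeasure_map hWm
  have hJ := map_prodMk_of_iIndepFun hA.aemeasurable hB.aemeasurable hWm h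
  rw [hA.map_eq, hB.map_eq] at hJ
  have htie : P {t | B t = W t + A t} = 0 := by
    have hnull := prod_erlangLaw_prod_eq_zero hn hμ ρ (P.map W)
    rwa [← hJ, Measure.map_apply_of_aemeasurable
      (hA.aemeasurable.prodMk (hB.aemeasurable.prodMk hWm))
      (measurableSet_eq_fun (by fun_prop) (by fun_prop))] at hnull
  calc P {t | W t = 0} = P {t | max 0 (B t - A t - W t) = 0} :=
        hW.measure_mem_eq (measurableSet_singleton 0)
    _ = P ({t | B t < W t + A t} ∪ {t | B t = W t + A t}) := by
        congr 1
        ext t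
        simp only [Set.mem_ofPred_eq, max_eq_left_iff, Set.mem_union]
        rw [← le_iff_lt_or_eq, sub_sub, sub_nonpos, add_comm]
    _ = P {t | B t < W t + A t} :=
        measure_congr (union_ae_eq_left_of_ae_eq_empty (ae_eq_empty.2 htie))

theorem theorem1 (n : ℕ) (hn : 1 ≤ n) (μ : ℝ) (hμ : 0 < μ)
    (FA : Measure ℝ) [IsProbabilityMeasure FA] (hFA : ∀ᵐ a ∂FA, 0 ≤ a) :
    -- the stationary law exists and is unique
    (∃! ν : Measure ℝ, IsStationaryLaw FA (erlangLaw n μ) ν) ∧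
    -- every stationary waiting time `W` is as follows
    ∀ (Ω : Type*) [MeasurableSpace Ω] (P : Measure Ω) [IsProbabilityMeasure P]
      (A B W : Ω → ℝ), HasLaw A FA P → HasLaw B (erlangLaw n μ) P →
      iIndepFun ![A, B, W] P →
      IdentDistrib W (fun t => max 0 (B t - A t - W t)) P P →
      ∀ (α ψ Φ : ℝ → ℝ) (p₀ : ℝ) (f : ℝ → ℝ),
        α = laplaceTransform (P.map A) →
        ψ = laplaceTransform (P.map W) →
        Φ = (fun s => ψ s * α s) →
        p₀ = 1 - ∑ i ∈ Finset.range n, (-μ) ^ i / (i ! : ℝ) * iteratedDeriv i Φ μ →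
        f = (fun x => μ ^ n * Real.exp (-(μ * x)) * ∑ i ∈ Finset.range n,
          (-1) ^ i / (i ! : ℝ) * iteratedDeriv i Φ μ *
            (x ^ (n - 1 - i) / ((n - 1 - i)! : ℝ))) →
        -- the transforms are smooth, so that the derivatives at `μ` are meaningful
        (ContDiffOn ℝ ∞ α (Set.Ioi 0) ∧ ContDiffOn ℝ ∞ ψ (Set.Ioi 0)) ∧
        -- the mass at the origin
        (P.real {t | W t = 0} = p₀ ∧ P.real {t | B t < W t + A t} = p₀) ∧
        -- the law of `W` is that mass plus the density `f` on `[0, ∞)`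
        (∀ x : ℝ, 0 ≤ x → 0 ≤ f x) ∧
        P.map W = ENNReal.ofReal p₀ • Measure.dirac 0 +
          (volume.restrict (Set.Ici 0)).withDensity (fun x => ENNReal.ofReal (f x)) ∧
        -- the derivatives of `Φ`
        (∀ i < n, iteratedDeriv i Φ μ = ∑ k ∈ Finset.range (i + 1),
          (i.choose k : ℝ) * iteratedDeriv k ψ μ * iteratedDeriv (i - k) α μ) ∧
        -- the derivatives of `ψ` at `μ` are the unique solution of the linear system
        SolvesBalanceSystem n μ (fun j => iteratedDeriv j α μ) (fun k => iteratedDeriv k ψ μ) ∧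
        ∀ y : ℕ → ℝ, SolvesBalanceSystem n μ (fun j => iteratedDeriv j α μ) y →
          ∀ k < n, y k = iteratedDeriv k ψ μ := by
  refine ⟨existsUnique_isStationaryLaw FA hn hμ hFA, ?_⟩
  intro Ω _ P _ A B W hA hB hind hW α ψ Φ p₀ f hα hψ hΦ hp₀ hf
  have hst := isStationaryLaw_of_identDistrib hA hB hind hW
  have hprob := hst.1
  have hae := hst.ae_nonneg
  have hc := ae_nonneg_conv hFA hae
  rw [hA.map_eq] at hα
  have hΦ' : Φ = fun s => laplaceTransform (P.map W) s * laplaceTransform FA s := by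
    rw [hΦ, hα, hψ]
  set q := meanWeight n μ (FA ∗ P.map W) with hq
  have hq0 : ∀ i, 0 ≤ q i := fun i => meanWeight_nonneg hμ n i hc
  have hqΦ : ∀ i < n, q i = (-μ) ^ i / i ! * iteratedDeriv i Φ μ := by
    intro i hi
    rw [hq, meanWeight_of_lt hi hμ _ hc, iteratedDeriv_laplaceTransform_conv FA _ hFA hae hμ, hΦ']
  have hqn : q n = p₀ := by
    have h1 := sum_meanWeight hμ n _ hc
    rw [Finset.sum_range_succ, Finset.sum_congr rfl fun i hi =>
      hqΦ i (Finset.mem_range.1 hi)] at h1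
    rw [hp₀]
    linarith
  have hfq : ∀ x, 0 ≤ x → f x = ∑ i ∈ Finset.range n, q i * erlangPDF (n - 1 - i) μ x := by
    intro x hx
    simp only [hf]
    rw [sum_mul_erlangPDF n μ (fun i => (-1) ^ i / (i ! : ℝ) * iteratedDeriv i Φ μ) hx]
    refine Finset.sum_congr rfl fun i hi => ?_
    rw [hqΦ i (Finset.mem_range.1 hi), neg_pow μ]
    ring
  have hlaw : P.map W = ENNReal.ofReal p₀ • Measure.dirac 0 +
      (volume.restrict (Set.Ici 0)).withDensity fun x => ENNReal.ofReal (f x) := by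
    rw [← hqn, ← erlangMix_eq_dirac_add_withDensity n hμ hq0 hfq]
    exact hst.eq_erlangMix FA hn hμ hFA
  have hmass : P {t | W t = 0} = ENNReal.ofReal p₀ := by
    have h := Measure.map_apply_of_aemeasurable hW.aemeasurable_fst
      (measurableSet_singleton (0 : ℝ))
    have hnull : ((volume.restrict (Set.Ici 0)).withDensity fun x => ENNReal.ofReal (f x))
        {(0 : ℝ)} = 0 :=
      (withDensity_absolutelyContinuous _ _).trans Measure.absolutelyContinuous_restrict
        Real.volume_singleton
    rw [hlaw] at h
    simp only [Measure.add_apply, hnull, Measure.smul_apply, smul_eq_mul,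
      Measure.dirac_apply_of_mem (Set.mem_singleton (0 : ℝ)), mul_one, add_zero] at h
    exact h.symm
  have hp₀0 : 0 ≤ p₀ := hqn ▸ hq0 n
  have hsys := hst.solvesBalanceSystem FA hn hμ hFA
  refine ⟨⟨hα ▸ contDiffOn_laplaceTransform FA hFA, hψ ▸ contDiffOn_laplaceTransform _ hae⟩,
    ⟨?_, ?_⟩, fun x hx => ?_, hlaw, fun i _ => ?_, ?_, fun y hy => ?_⟩
  · rw [measureReal_def, hmass, ENNReal.toReal_ofReal hp₀0]
  · rw [measureReal_def, ← measure_eq_zero_eq_measure_lt hn hμ hA hB hind hW, hmass,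
      ENNReal.toReal_ofReal hp₀0]
  · rw [hfq x hx]
    exact Finset.sum_nonneg fun i _ => mul_nonneg (hq0 i) (erlangPDF_nonneg _ hμ x)
  · rw [hΦ', hα, hψ]
    exact iteratedDeriv_laplaceTransform_mul FA _ hFA hae hμ i
  · rw [hα, hψ]
    exact hsys
  · rw [hα] at hy
    rw [hψ]
    exact hy.unique FA hn hμ hFA hsys
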